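/- Write points of $\mathbb R^n$, $n\ge 1$, as $x=(x',x_n)$ with $x'\in\mathbb R^{n-1}$, and let $B_r$ be the open ball of radius $r$ centred at $0$. For every $n$ and every $\rho>0$ there are constants $C',c'>0$, depending only on $n$ and $\rho$, with the following property. Let $\Omega\subset\mathbb R^n$ be an open convex set with $0\in\partial\Omega$ and $\Omega\subset\{x_n>0\}\cap B_{1/\rho}$, which has an interior tangent ball of radius $\rho$ at the origin (a ball of radius $\rho$ contained in $\Omega$ whose boundary contains $0$). Let $u:\overline\Omega\to\mathbb R$ be continuous and convex with $u\ge 0$, $u(0)=0$, and $\nabla u(0)=0$ in the sense that for no $t>0$ does $u(x)\ge t\,x_n$ hold for all $x\in\overline\Omega$. Suppose that $$\rho|x'|^2\le u(x)\quad\text{for } x\in\partial\Omega,\qquad u(x)\le\frac1\rho|x'|^2\quad\text{for } x\in\partial\Omega\cap B_\rho,$$ and that $\det D^2u\le\frac1\rho$ in $\Omega$ in the sense of Alexandrov, i.e. $\left|\bigcup_{x\in E}\partial u(x)\right|\le\frac1\rho|E|$ for every Borel set $E\subset\Omega$, where $\partial u(x)$ is the subdifferential of $u$ at $x$ and $|\cdot|$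 is Lebesgue measure. Then $$u(x)\le C'|x|^{4/3}\qquad\text{for all } x\in\Omega\cap B_{c'}.$$ In particular this holds if $\rho|x'|^2\le u(x)\le\frac1\rho|x'|^2$ on all of $\partial\Omega$. -/

import Mathlib

open MeasureTheory
open scoped ENNReal

namespace DegenerateMA

/-- The Euclidean space of dimension `n + 1`; the last coordinate is the distinguished one. -/
abbrev Space (n : ℕ) : Type := EuclideanSpace ℝ (Fin (n + 1))

/-- The first `n` coordinates `x'` of `x = (x', xₙ)`, with the Euclidean norm. -/
def tang {n : ℕ} (x : Space n) : EuclideanSpace ℝ (Fin n) :=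
  WithLp.toLp 2 (fun i => x i.castSucc)

/-- The last coordinate `xₙ` of `x = (x', xₙ)`. -/
def height {n : ℕ} (x : Space n) : ℝ := x (Fin.last n)

/-- `Ω` is open and convex, `0 ∈ ∂Ω`, `Ω ⊆ {xₙ > 0} ∩ B_{1/ρ}`, and `Ω` has an interior
tangent ball of radius `ρ` at the origin. -/
structure HypH1 {n : ℕ} (ρ : ℝ) (Ω : Set (Space n)) : Prop where
  isOpen : IsOpen Ω
  convex : Convex ℝ Ω
  zero_mem_frontier : (0 : Space n) ∈ frontier Ω
  subset_halfSpace : ∀ x ∈ Ω, 0 < height x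
  subset_ball : Ω ⊆ Metric.ball 0 (1 / ρ)
  tangent_ball : ∃ z : Space n, dist 0 z = ρ ∧ Metric.ball z ρ ⊆ Ω

/-- `u` is a continuous convex function on the closure of `Ω`, `u ≥ 0`, `u 0 = 0`, and
`∇u(0) = 0` in the sense that for no `t > 0` is the plane `x_{n+1} = t xₙ` a supporting plane
of the graph of `u` at `0`. -/
structure HypH2 {n : ℕ} (Ω : Set (Space n)) (u : Space n → ℝ) : Prop where
  convexOn : ConvexOn ℝ (closure Ω) u
  continuousOn : ContinuousOn u (closure Ω)
  nonneg : ∀ x ∈ closure Ω, 0 ≤ u x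
  map_zero : u 0 = 0
  not_supporting : ∀ t : ℝ, 0 < t → ¬ ∀ x ∈ closure Ω, t * height x ≤ u x

/-- The subdifferential at `x` of a function `u` on `Ω`: the slopes of the supporting planes
of the graph of `u` at `x`. -/
def subdifferential {n : ℕ} (Ω : Set (Space n)) (u : Space n → ℝ) (x : Space n) :
    Set (Space n) :=
  {p | ∀ y ∈ Ω, u x + inner ℝ p (y - x) ≤ u y}

/-- The Monge-Ampère measure (in the sense of Alexandrov) of a convex function `u` on `Ω`:
the set `E` gets the Lebesgue measure of the union of the subdifferentials of `u` at the
points of `E`. -/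
noncomputable def mongeAmpere {n : ℕ} (Ω : Set (Space n)) (u : Space n → ℝ)
    (E : Set (Space n)) : ℝ≥0∞ :=
  volume (⋃ x ∈ E, subdifferential Ω u x)

/-- `det D²u ≤ K` in `Ω`, as an inequality between the Monge-Ampère measure of `u` and `K`
times the Lebesgue measure, on the Borel subsets of `Ω`. -/
def DetHessianLE {n : ℕ} (Ω : Set (Space n)) (u : Space n → ℝ) (K : ℝ) : Prop :=
  ∀ E : Set (Space n), MeasurableSet E → E ⊆ Ω →
    mongeAmpere Ω u E ≤ ENNReal.ofReal K * volume E

end DegenerateMA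

namespace DegenerateMA

/-! ### Coordinates and anisotropic linear maps -/

variable {n : ℕ}

/-! Everything rests on comparison with quadratics of larger Monge-Ampère measure
(`quad_le_of_le_frontier`).

From below, `ρ|x'|² - M xₙ ≤ u` for some `M`. Comparison in truncated cylinders improves this:
shrinking the radius by 256 shrinks the slope by 16, so at radius `R` the slope is of order
`R^(1/2)` (`lowerBound_all`).

At the height `δ ~ R^(3/2)` where slope times height is `ρR²/2`, some `y` has `u y ≤ ρR²/2`;
otherwise a quadratic with positive slope in `xₙ` would fit below `u`, against `∇u(0) = 0`
(`exists_le_at_height`). The lower bound then forces `|y'| ≤ R`. A point `x` with `|x| < δ/2` lies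
between `y` and a boundary point with `|z'| ≤ 2R`, and convexity gives `u x ≤ C R² ~ δ^(4/3)`
(`le_of_norm_lt`). -/

theorem tang_add (x y : Space n) : tang (x + y) = tang x + tang y := rfl

theorem tang_sub (x y : Space n) : tang (x - y) = tang x - tang y := rfl

theorem tang_smul (c : ℝ) (x : Space n) : tang (c • x) = c • tang x := rfl

theorem height_add (x y : Space n) : height (x + y) = height x + height y := rfl

theorem height_sub (x y : Space n) : height (x - y) = height x - height y := rfl

theorem height_smul (c : ℝ) (x : Space n) : height (c • x) = c * height x := rfl

theorem continuous_height : Continuous (height : Space n → ℝ) := by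
  unfold height; fun_prop

theorem continuous_tang : Continuous (tang : Space n → EuclideanSpace ℝ (Fin n)) := by
  unfold tang; fun_prop

theorem inner_eq_tang_add_height (x y : Space n) :
    inner ℝ x y = inner ℝ (tang x) (tang y) + height x * height y := by
  simp only [PiLp.inner_apply, Fin.sum_univ_castSucc, tang, height]
  simp [mul_comm]

theorem norm_sq_eq_tang_add_height (x : Space n) :
    ‖x‖ ^ 2 = ‖tang x‖ ^ 2 + height x ^ 2 := by
  rw [← real_inner_self_eq_norm_sq, inner_eq_tang_add_height, real_inner_self_eq_norm_sq, sq (height x)]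

theorem norm_tang_le (x : Space n) : ‖tang x‖ ≤ ‖x‖ := by
  have := norm_sq_eq_tang_add_height x
  exact le_of_sq_le_sq (by nlinarith [sq_nonneg (height x)]) (norm_nonneg _)

theorem abs_height_le (x : Space n) : |height x| ≤ ‖x‖ := by
  have := norm_sq_eq_tang_add_height x
  exact abs_le_of_sq_le_sq (by nlinarith [sq_nonneg ‖tang x‖]) (norm_nonneg _)

theorem norm_le_tang_add_height (x : Space n) : ‖x‖ ≤ ‖tang x‖ + |height x| := by
  have := norm_sq_eq_tang_add_height x
  refine le_of_sq_le_sq ?_ (by positivity)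
  have := sq_abs (height x)
  nlinarith [mul_nonneg (norm_nonneg (tang x)) (abs_nonneg (height x))]

theorem exists_tang_height (b : EuclideanSpace ℝ (Fin n)) (β : ℝ) :
    ∃ x : Space n, tang x = b ∧ height x = β := by
  refine ⟨WithLp.toLp 2 (Fin.snoc (α := fun _ => ℝ) (fun i => b i) β), ?_, ?_⟩
  · ext i; simp [tang]
  · simp [height]

/-- The linear map `(x', xₙ) ↦ (a x', A xₙ)`. -/
noncomputable def diagMap (n : ℕ) (a A : ℝ) : Space n →ₗ[ℝ] Space n :=
  Matrix.toEuclideanLin (Matrix.diagonal (Fin.snoc (α := fun _ => ℝ) (fun _ => a) A))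

theorem tang_diagMap (a A : ℝ) (x : Space n) : tang (diagMap n a A x) = a • tang x := by
  ext i
  simp [diagMap, tang, Matrix.mulVec_diagonal]

theorem height_diagMap (a A : ℝ) (x : Space n) : height (diagMap n a A x) = A * height x := by
  simp [diagMap, height, Matrix.mulVec_diagonal]

theorem det_diagMap (a A : ℝ) : LinearMap.det (diagMap n a A) = a ^ n * A := by
  rw [diagMap, Matrix.toEuclideanLin_eq_toLin_orthonormal, LinearMap.det_toLin,
    Matrix.det_diagonal, Fin.prod_univ_castSucc]
  simp

/-! ### Comparison with quadratic polynomials -/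

/-- The convex quadratic polynomial `c + b · x + a |x'|² + A xₙ²`. -/
noncomputable def quad (a A c : ℝ) (b x : Space n) : ℝ :=
  c + inner ℝ b x + a * ‖tang x‖ ^ 2 + A * height x ^ 2

theorem continuous_quad (a A c : ℝ) (b : Space n) : Continuous (quad a A c b) := by
  have h1 := continuous_height (n := n)
  have h2 := continuous_tang (n := n)
  unfold quad
  fun_prop

theorem quad_tangent_le {a A : ℝ} (ha : 0 ≤ a) (hA : 0 ≤ A) (c : ℝ) (b x y : Space n) :
    quad a A c b x + inner ℝ (b + diagMap n (2 * a) (2 * A) x) (y - x) ≤ quad a A c b y := by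
  have h1 : ‖tang y - tang x‖ ^ 2 = ‖tang y‖ ^ 2 - 2 * inner ℝ (tang x) (tang y) + ‖tang x‖ ^ 2 := by
    rw [norm_sub_sq_real, real_inner_comm]
  have h2 : quad a A c b y - quad a A c b x - inner ℝ (b + diagMap n (2 * a) (2 * A) x) (y - x)
      = a * ‖tang y - tang x‖ ^ 2 + A * (height y - height x) ^ 2 := by
    rw [h1, inner_add_left, inner_eq_tang_add_height (diagMap n (2 * a) (2 * A) x), tang_diagMap,
      height_diagMap, tang_sub, height_sub, inner_smul_left, inner_sub_right, inner_sub_right,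
      real_inner_self_eq_norm_sq]
    simp only [quad, conj_trivial]
    ring
  have h3 : 0 ≤ a * ‖tang y - tang x‖ ^ 2 + A * (height y - height x) ^ 2 := by positivity
  linarith

open scoped Pointwise in
theorem volume_image_add_diagMap {a A : ℝ} (ha : 0 ≤ a) (hA : 0 ≤ A) (b : Space n)
    (E : Set (Space n)) :
    volume ((fun x => b + diagMap n a A x) '' E) = ENNReal.ofReal (a ^ n * A) * volume E := by
  have : (fun x => b + diagMap n a A x) '' E = b +ᵥ (diagMap n a A '' E) := by
    ext y; simp [Set.mem_vadd_set]
  rw [this, measure_vadd, Measure.addHaar_image_linearMap, det_diagMap, abs_of_nonneg (by positivity)]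

/-- Comparison principle: a quadratic polynomial with larger Monge-Ampère measure than `u` which
lies below `u` on the boundary of `D` lies below `u` in `D`. -/
theorem quad_le_of_le_frontier {Ω D : Set (Space n)} {u : Space n → ℝ} {K a A c : ℝ}
    {b : Space n} (hD : IsOpen D) (hDΩ : D ⊆ Ω)
    (hbdd : Bornology.IsBounded D) (hconv : ConvexOn ℝ (closure Ω) u)
    (hcont : ContinuousOn u (closure Ω)) (hdet : DetHessianLE Ω u K)
    (ha : 0 ≤ a) (hA : 0 ≤ A) (hK0 : 0 ≤ K) (hK : K < (2 * a) ^ n * (2 * A))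
    (hfr : ∀ x ∈ frontier D, quad a A c b x ≤ u x) :
    ∀ x ∈ closure D, quad a A c b x ≤ u x := by
  have hcD : ContinuousOn u (closure D) := hcont.mono (closure_mono hDΩ)
  set E : Set (Space n) := {x | x ∈ D ∧ u x < quad a A c b x} with hE
  have hEopen : IsOpen E := by
    have h1 : ContinuousOn (fun x => u x - quad a A c b x) D :=
      (hcD.mono subset_closure).sub (continuous_quad a A c b).continuousOn
    have h2 := h1.isOpen_inter_preimage hD (isOpen_Iio (a := (0 : ℝ)))
    convert h2 using 1
    ext x
    simp [hE]
  have hEsub : E ⊆ Ω := fun x hx => hDΩ hx.1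
  have himg : (fun x => b + diagMap n (2 * a) (2 * A) x) '' E ⊆ ⋃ x ∈ E, subdifferential Ω u x := by
    rintro _ ⟨x₀, hx₀, rfl⟩
    set p := b + diagMap n (2 * a) (2 * A) x₀ with hp
    have hcomp : IsCompact (closure D) := hbdd.isCompact_closure
    have hcg : ContinuousOn (fun x => u x - inner ℝ p x) (closure D) :=
      hcD.sub (by fun_prop)
    -- Lower the plane of slope `p` until it supports `u` over `closure D`. The contact point lies
    -- in `E`: there `u` is below the tangent plane of the quadratic at `x₀`, hence below the
    -- quadratic. Convexity makes the support global.
    obtain ⟨x₁, hx₁, hmin⟩ := hcomp.exists_isMinOn ⟨x₀, subset_closure hx₀.1⟩ hcg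
    have hm0 := hmin (subset_closure hx₀.1)
    have htan := quad_tangent_le ha hA c b x₀ x₁
    rw [← hp, inner_sub_right] at htan
    simp only [Set.mem_ofPred_eq] at hm0
    have hlt : u x₁ < quad a A c b x₁ := by linarith [hx₀.2]
    have hx₁D : x₁ ∈ D := by
      rw [closure_eq_self_union_frontier] at hx₁
      rcases hx₁ with h | h
      · exact h
      · exact absurd (hfr x₁ h) (not_le.mpr hlt)
    refine Set.mem_biUnion (show x₁ ∈ E from ⟨hx₁D, hlt⟩) ?_
    have hloc : IsLocalMinOn (fun x => u x - inner ℝ p x) (closure Ω) x₁ := by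
      refine Filter.Eventually.filter_mono nhdsWithin_le_nhds ?_
      filter_upwards [hD.mem_nhds hx₁D] with x hx
      exact hmin (subset_closure hx)
    have hcv : ConvexOn ℝ (closure Ω) (fun x => u x - inner ℝ p x) :=
      hconv.sub ((innerSL ℝ p).toLinearMap.concaveOn hconv.1)
    have hglob := IsMinOn.of_isLocalMinOn_of_convexOn (subset_closure (hDΩ hx₁D)) hloc hcv
    intro y hy
    have := hglob (subset_closure hy)
    simp only [Set.mem_ofPred_eq] at this
    rw [inner_sub_right]
    linarith
  have hE0 : volume E = 0 := by
    by_contra hne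
    have h1 := (measure_mono himg).trans (hdet E hEopen.measurableSet hEsub)
    rw [volume_image_add_diagMap (by positivity) (by positivity)] at h1
    have hfin : volume E ≠ ⊤ := (hbdd.subset fun x hx => hx.1).measure_lt_top.ne
    rw [ENNReal.mul_le_mul_iff_left hne hfin] at h1
    exact absurd ((ENNReal.ofReal_le_ofReal_iff hK0).mp h1) (not_le.mpr hK)
  have hEe : E = ∅ := (hEopen.measure_eq_zero_iff volume).mp hE0
  intro x hx
  rw [closure_eq_self_union_frontier] at hx
  rcases hx with h | h
  · by_contra hlt
    exact (Set.eq_empty_iff_forall_notMem.mp hEe x) ⟨h, not_le.mp hlt⟩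
  · exact hfr x h

end DegenerateMA

/-! ### Truncated domains and the boundary near the origin -/

namespace DegenerateMA

variable {n : ℕ}

/-- The part of `Ω` in the cylinder `|x'| < r`, below the height `s`. -/
def truncate (Ω : Set (Space n)) (r s : ℝ) : Set (Space n) :=
  Ω ∩ {x | ‖tang x‖ < r ∧ height x < s}

theorem isOpen_cylinder (r s : ℝ) : IsOpen {x : Space n | ‖tang x‖ < r ∧ height x < s} :=
  (isOpen_lt continuous_tang.norm continuous_const).inter
    (isOpen_lt continuous_height continuous_const)

theorem mem_closure_truncate {Ω : Set (Space n)} {r s : ℝ} {x : Space n} (hx : x ∈ closure Ω)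
    (hr : ‖tang x‖ < r) (hs : height x < s) : x ∈ closure (truncate Ω r s) :=
  (isOpen_cylinder r s).closure_inter ⟨hx, hr, hs⟩

theorem frontier_truncate {Ω : Set (Space n)} (hΩ : IsOpen Ω) {r s : ℝ} {x : Space n}
    (hx : x ∈ frontier (truncate Ω r s)) :
    x ∈ closure Ω ∧ ‖tang x‖ ≤ r ∧ height x ≤ s ∧
      (x ∈ frontier Ω ∨ ‖tang x‖ = r ∨ height x = s) := by
  have hopen : IsOpen (truncate Ω r s) := hΩ.inter (isOpen_cylinder r s)
  rw [hopen.frontier_eq] at hx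
  have h1 : x ∈ closure Ω := closure_mono Set.inter_subset_left hx.1
  have h2 : ‖tang x‖ ≤ r ∧ height x ≤ s := by
    have hcl : IsClosed {x : Space n | ‖tang x‖ ≤ r ∧ height x ≤ s} :=
      (isClosed_le continuous_tang.norm continuous_const).inter
        (isClosed_le continuous_height continuous_const)
    have hsub : truncate Ω r s ⊆ {x : Space n | ‖tang x‖ ≤ r ∧ height x ≤ s} :=
      fun y hy => ⟨hy.2.1.le, hy.2.2.le⟩
    exact closure_minimal hsub hcl hx.1
  refine ⟨h1, h2.1, h2.2, ?_⟩
  by_contra! hcon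
  obtain ⟨hf, hr, hs⟩ := hcon
  rw [hΩ.frontier_eq] at hf
  have hxΩ : x ∈ Ω := by
    by_contra h
    exact hf ⟨h1, h⟩
  exact hx.2 ⟨hxΩ, lt_of_le_of_ne h2.1 hr, lt_of_le_of_ne h2.2 hs⟩

variable {ρ : ℝ} {Ω : Set (Space n)} {u : Space n → ℝ}

theorem HypH1.height_nonneg (h : HypH1 ρ Ω) {x : Space n} (hx : x ∈ closure Ω) : 0 ≤ height x :=
  closure_minimal (fun y hy => (h.subset_halfSpace y hy).le)
    (isClosed_le continuous_const continuous_height) hx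

theorem HypH1.norm_le (h : HypH1 ρ Ω) {x : Space n} (hx : x ∈ closure Ω) : ‖x‖ ≤ 1 / ρ := by
  have := closure_mono h.subset_ball hx
  simpa using Metric.closure_ball_subset_closedBall this

theorem HypH1.isBounded (h : HypH1 ρ Ω) : Bornology.IsBounded Ω :=
  Metric.isBounded_ball.subset h.subset_ball

theorem HypH1.lt_one (h : HypH1 ρ Ω) (hρ : 0 < ρ) : ρ < 1 := by
  obtain ⟨z, hz, hball⟩ := h.tangent_ball
  have h1 := h.subset_ball (hball (Metric.mem_ball_self hρ))
  rw [Metric.mem_ball, dist_comm, hz, lt_div_iff₀ hρ] at h1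
  nlinarith

theorem HypH1.zero_mem_closure (h : HypH1 ρ Ω) : (0 : Space n) ∈ closure Ω :=
  frontier_subset_closure h.zero_mem_frontier

/-- Near the origin, the boundary of `Ω` lies below a paraboloid. -/
theorem HypH1.mul_height_le (h : HypH1 ρ Ω) (hρ : 0 < ρ) {x : Space n} (hx : x ∈ frontier Ω)
    (hxρ : height x ≤ ρ) : ρ * height x ≤ ‖tang x‖ ^ 2 := by
  obtain ⟨z, hz, hball⟩ := h.tangent_ball
  have hnz : ‖z‖ = ρ := by simpa using hz
  obtain ⟨e, he1, he2⟩ := exists_tang_height (n := n) 0 1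
  have hen : ‖e‖ = 1 := by
    have := norm_sq_eq_tang_add_height e
    rw [he1, he2] at this
    norm_num at this
    rcases this with h | h
    · exact h
    · linarith [norm_nonneg e]
  -- The lowest point of the tangent ball has nonnegative height; with `‖z‖ = ρ` this puts the
  -- centre on the `xₙ`-axis.
  have hzh : ρ ≤ height z := by
    have hmem : z - ρ • e ∈ closure (Metric.ball z ρ) := by
      rw [closure_ball z hρ.ne']
      simp [norm_smul, hen, abs_of_pos hρ]
    have := h.height_nonneg (closure_mono hball hmem)
    rw [height_sub, height_smul, he2] at this
    linarith
  have hsq := norm_sq_eq_tang_add_height z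
  rw [hnz] at hsq
  have htz : tang z = 0 := by
    have : ‖tang z‖ ^ 2 ≤ 0 := by nlinarith
    have : ‖tang z‖ ^ 2 = 0 := le_antisymm this (by positivity)
    simpa using this
  have hhz : height z = ρ := by
    have := abs_height_le z
    rw [hnz] at this
    exact le_antisymm ((le_abs_self _).trans this) hzh
  have hxn : x ∉ Metric.ball z ρ := by
    intro hmem
    rw [h.isOpen.frontier_eq] at hx
    exact hx.2 (hball hmem)
  rw [Metric.mem_ball, dist_eq_norm, not_lt] at hxn
  have hd := norm_sq_eq_tang_add_height (x - z)
  rw [tang_sub, htz, sub_zero, height_sub, hhz] at hd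
  have h0 := h.height_nonneg (frontier_subset_closure hx)
  nlinarith

/-- Convexity along the rays through the origin. -/
theorem HypH2.map_smul_le (h : HypH2 Ω u) (h0 : (0 : Space n) ∈ closure Ω) {x : Space n}
    (hx : x ∈ closure Ω) {c : ℝ} (hc0 : 0 ≤ c) (hc1 : c ≤ 1) :
    c • x ∈ closure Ω ∧ u (c • x) ≤ c * u x := by
  have h1 := h.convexOn.1 hx h0 hc0 (sub_nonneg.mpr hc1) (by ring)
  have h2 := h.convexOn.2 hx h0 hc0 (sub_nonneg.mpr hc1) (by ring)
  simpa [h.map_zero] using And.intro h1 h2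

/-! ### Decay of the slope in the lower bound -/

/-- `u` lies above `ρ |x'|² - M xₙ` in the cylinder `|x'| ≤ r`. -/
def LowerBound (ρ : ℝ) (Ω : Set (Space n)) (u : Space n → ℝ) (r M : ℝ) : Prop :=
  ∀ x ∈ closure Ω, ‖tang x‖ ≤ r → ρ * ‖tang x‖ ^ 2 - M * height x ≤ u x

/-- Comparison with a quadratic polynomial which touches `ρ |x'|²` along `{x' = x₀'}` up to a
multiple of `xₙ`. -/
theorem lower_bound_of_le_frontier (hρ : 0 < ρ) (h1 : HypH1 ρ Ω) (h2 : HypH2 Ω u)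
    (hdet : DetHessianLE Ω u (1 / ρ)) {a A M : ℝ} (ha : 0 ≤ a) (hA : 0 ≤ A)
    (hK : 1 / ρ < (2 * a) ^ n * (2 * A)) {D : Set (Space n)} (hD : IsOpen D) (hDΩ : D ⊆ Ω)
    {x₀ : Space n} (hx₀ : x₀ ∈ closure D)
    (hfr : ∀ x ∈ frontier D, ρ * ‖tang x‖ ^ 2 - (ρ - a) * ‖tang x - tang x₀‖ ^ 2
      - M * height x + A * height x ^ 2 ≤ u x) :
    ρ * ‖tang x₀‖ ^ 2 - M * height x₀ ≤ u x₀ := by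
  obtain ⟨b, hb1, hb2⟩ := exists_tang_height ((2 * (ρ - a)) • tang x₀) (-M)
  have key : ∀ x, quad a A (-(ρ - a) * ‖tang x₀‖ ^ 2) b x = ρ * ‖tang x‖ ^ 2
      - (ρ - a) * ‖tang x - tang x₀‖ ^ 2 - M * height x + A * height x ^ 2 := by
    intro x
    rw [quad, inner_eq_tang_add_height, hb1, hb2, norm_sub_sq_real, inner_smul_left,
      real_inner_comm]
    simp only [conj_trivial]
    ring
  have := quad_le_of_le_frontier (c := -(ρ - a) * ‖tang x₀‖ ^ 2) (b := b) hD hDΩ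
    (h1.isBounded.subset hDΩ) h2.convexOn h2.continuousOn hdet ha hA (by positivity) hK
    (fun x hx => (key x).trans_le (hfr x hx)) x₀ hx₀
  rw [key] at this
  simp only [sub_self, norm_zero] at this
  nlinarith [mul_nonneg hA (sq_nonneg (height x₀))]

theorem lowerBound_initial (hρ : 0 < ρ) (h1 : HypH1 ρ Ω) (h2 : HypH2 Ω u)
    (hlow : ∀ x ∈ frontier Ω, ρ * ‖tang x‖ ^ 2 ≤ u x)
    (hdet : DetHessianLE Ω u (1 / ρ)) {a A M : ℝ} (ha : 0 ≤ a) (haρ : a ≤ ρ) (hA : 0 ≤ A)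
    (hK : 1 / ρ < (2 * a) ^ n * (2 * A)) (hM : A / ρ ≤ M) (r : ℝ) :
    LowerBound ρ Ω u r M := by
  intro x₀ hx₀ _
  refine lower_bound_of_le_frontier hρ h1 h2 hdet ha hA hK h1.isOpen subset_rfl hx₀ ?_
  intro x hx
  have hxc := frontier_subset_closure hx
  have hh0 := h1.height_nonneg hxc
  have hh1 : height x ≤ 1 / ρ := (le_abs_self _).trans ((abs_height_le x).trans (h1.norm_le hxc))
  have hAM : A * height x ≤ M := by
    refine le_trans (mul_le_mul_of_nonneg_left hh1 hA) ?_
    rwa [mul_one_div]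
  have h3 : 0 ≤ (ρ - a) * ‖tang x - tang x₀‖ ^ 2 :=
    mul_nonneg (sub_nonneg.mpr haρ) (by positivity)
  nlinarith [hlow x hx, mul_le_mul_of_nonneg_right hAM hh0]

/-- The old bound is needed only on the lateral side `|x'| = r`, and only at small heights; higher
up the barrier is already nonpositive. This is what allows the smaller slope. -/
theorem lowerBound_improve (hρ : 0 < ρ) (h1 : HypH1 ρ Ω) (h2 : HypH2 Ω u)
    (hlow : ∀ x ∈ frontier Ω, ρ * ‖tang x‖ ^ 2 ≤ u x)
    (hdet : DetHessianLE Ω u (1 / ρ)) {A r M : ℝ} (hA : 0 < A)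
    (hK : 1 / ρ < (2 * (ρ / 128)) ^ n * (2 * A)) (hr : 0 < r) (hM : 0 < M)
    (hMr : 1024 * A * ρ * r ^ 2 ≤ M ^ 2) (hQ : LowerBound ρ Ω u r M) :
    LowerBound ρ Ω u (r / 256) (M / 16) := by
  intro x₀ hx₀ hxr
  set m := M / 16 with hm
  have hMm : M = 16 * m := by rw [hm]; ring
  have hmpos : 0 < m := by positivity
  -- Up to height `s` the term `A xₙ²` costs at most half of `m xₙ`; from `s` on, `m xₙ` exceeds
  -- `ρr²` and the claim is trivial.
  set s := m / (2 * A) with hs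
  have hAs : A * s = m / 2 := by rw [hs]; field_simp
  have hspos : 0 < s := by positivity
  have hrs : ρ * r ^ 2 ≤ m / 2 * s := by
    have : A * (ρ * r ^ 2) ≤ A * (m / 2 * s) := by
      have : A * (m / 2 * s) = m / 2 * (m / 2) := by rw [← hAs]; ring
      rw [this]
      rw [hMm] at hMr
      nlinarith
    exact le_of_mul_le_mul_left this hA
  by_cases hxs : height x₀ < s
  swap
  · have h3 : ‖tang x₀‖ ^ 2 ≤ r ^ 2 := by
      have : ‖tang x₀‖ ≤ r := by linarith
      gcongr
    have h4 := h2.nonneg x₀ hx₀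
    nlinarith [mul_le_mul_of_nonneg_left (not_lt.mp hxs) hmpos.le, mul_le_mul_of_nonneg_left h3 hρ.le,
      mul_pos hmpos hspos]
  refine lower_bound_of_le_frontier hρ h1 h2 hdet (a := ρ / 128) (by positivity) hA.le hK
    (h1.isOpen.inter (isOpen_cylinder r s)) Set.inter_subset_left
    (mem_closure_truncate hx₀ (by linarith) hxs) ?_
  intro x hx
  obtain ⟨hxc, hxr', hxs', hcases⟩ := frontier_truncate h1.isOpen hx
  have hh0 := h1.height_nonneg hxc
  have hquad : A * height x ^ 2 ≤ m / 2 * height x := by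
    have := mul_le_mul_of_nonneg_left hxs' hA.le
    rw [hAs] at this
    nlinarith [mul_le_mul_of_nonneg_right this hh0]
  have hd0 : 0 ≤ (ρ - ρ / 128) * ‖tang x - tang x₀‖ ^ 2 :=
    mul_nonneg (by linarith) (by positivity)
  have hmh : 0 ≤ m * height x := by positivity
  rcases hcases with hf | hf | hf
  · linarith [hlow x hf]
  · have hnn := h2.nonneg x hxc
    have hq := hQ x hxc hxr'
    have hd : 255 / 256 * r ≤ ‖tang x - tang x₀‖ := by
      have := norm_sub_norm_le (tang x) (tang x₀)
      rw [hf] at this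
      linarith
    have hd2 : (255 / 256 * r) ^ 2 ≤ ‖tang x - tang x₀‖ ^ 2 := by gcongr
    rw [hf] at hq ⊢
    have hd3 : (1 - 1 / 64) * (ρ * r ^ 2) ≤ (ρ - ρ / 128) * ‖tang x - tang x₀‖ ^ 2 := by
      have := mul_le_mul_of_nonneg_left hd2 (show 0 ≤ ρ - ρ / 128 by linarith)
      nlinarith [mul_pos hρ (pow_pos hr 2)]
    rw [hMm] at hq
    -- The barrier is at most `ρr²/64 - (m/2) xₙ`. Either this is nonpositive, or `16 m xₙ < ρr²/2`
    -- and the old bound gives `u x ≥ ρr²/2`.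
    by_cases hcase : ρ * r ^ 2 / 64 ≤ m / 2 * height x
    · linarith
    · linarith
  · rw [hf] at hquad hmh ⊢
    have hnn := h2.nonneg x hxc
    have : ρ * ‖tang x‖ ^ 2 ≤ ρ * r ^ 2 := by gcongr
    linarith

theorem lowerBound_all (hρ : 0 < ρ) (h1 : HypH1 ρ Ω) (h2 : HypH2 Ω u)
    (hlow : ∀ x ∈ frontier Ω, ρ * ‖tang x‖ ^ 2 ≤ u x)
    (hdet : DetHessianLE Ω u (1 / ρ)) {A M : ℝ} (hA : 0 < A)
    (hK : 1 / ρ < (2 * (ρ / 128)) ^ n * (2 * A)) (hM : 0 < M)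
    (hM1 : A / ρ ≤ M) (hM2 : 1024 * A * ρ * (1 / ρ) ^ 2 ≤ M ^ 2) {q : ℝ} (hq0 : 0 < q)
    (hq1 : q ≤ 1) : LowerBound ρ Ω u (q ^ 2 / ρ) (16 * M * q) := by
  have hind : ∀ j : ℕ, LowerBound ρ Ω u ((1 / 256) ^ j / ρ) (M * (1 / 16) ^ j) := by
    intro j
    induction j with
    | zero =>
      exact lowerBound_initial hρ h1 h2 hlow hdet (a := ρ / 128) (by positivity) (by linarith)
        hA.le hK (by simpa using hM1) _
    | succ j ih =>
      have h256 : ((1 : ℝ) / 256) ^ j = ((1 / 16) ^ j) ^ 2 := by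
        rw [← pow_mul, mul_comm, pow_mul]; norm_num
      have hp : 0 < ((1 : ℝ) / 16) ^ j := by positivity
      have hp1 : ((1 : ℝ) / 16) ^ j ≤ 1 := pow_le_one₀ (by norm_num) (by norm_num)
      have := lowerBound_improve hρ h1 h2 hlow hdet hA hK (r := (1 / 256) ^ j / ρ)
        (M := M * (1 / 16) ^ j) (by positivity) (by positivity) ?_ ih
      · convert this using 1 <;> ring
      -- The smallness condition persists: `r²` scales by `p⁴`, but `M²` only by `p²`.
      · rw [h256]
        set p := ((1 : ℝ) / 16) ^ j
        have e1 : 1024 * A * ρ * (p ^ 2 / ρ) ^ 2 = (1024 * A * ρ * (1 / ρ) ^ 2) * p ^ 2 * p ^ 2 := by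
          ring
        rw [e1, mul_pow]
        have hpp : p ^ 2 ≤ 1 := pow_le_one₀ hp.le hp1
        calc (1024 * A * ρ * (1 / ρ) ^ 2) * p ^ 2 * p ^ 2
            ≤ (1024 * A * ρ * (1 / ρ) ^ 2) * p ^ 2 * 1 := by gcongr
          _ ≤ M ^ 2 * p ^ 2 := by rw [mul_one]; gcongr
  -- Rounding `q` up to a power of `1/16` costs the factor 16 in the slope.
  obtain ⟨j, hj1, hj2⟩ := exists_nat_pow_near_of_lt_one hq0 hq1 (y := (1 / 16 : ℝ)) (by norm_num)
    (by norm_num)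
  intro x hx hxr
  have hsq : q ^ 2 ≤ (1 / 256) ^ j := by
    calc q ^ 2 ≤ ((1 / 16) ^ j) ^ 2 := by gcongr
      _ = (1 / 256) ^ j := by rw [← pow_mul, mul_comm, pow_mul]; norm_num
  have hb := hind j x hx (hxr.trans (by gcongr))
  have hpj : M * (1 / 16) ^ j ≤ 16 * M * q := by
    rw [pow_succ] at hj1
    nlinarith
  linarith [mul_le_mul_of_nonneg_right hpj (h1.height_nonneg hx)]

end DegenerateMA

/-! ### A low point at height `δ` and the upper bound -/

namespace DegenerateMA

variable {n : ℕ} {ρ : ℝ} {Ω : Set (Space n)} {u : Space n → ℝ}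

/-- Sections of `u` cannot be too thin in the `xₙ` direction, since otherwise a quadratic
polynomial with positive slope at the origin would lie below `u`. -/
theorem exists_le_at_height (hρ : 0 < ρ) (h1 : HypH1 ρ Ω) (h2 : HypH2 Ω u)
    (hlow : ∀ x ∈ frontier Ω, ρ * ‖tang x‖ ^ 2 ≤ u x)
    (hdet : DetHessianLE Ω u (1 / ρ)) {A R M δ : ℝ} (hA : 0 < A)
    (hK : 1 / ρ < (2 * (ρ / 128)) ^ n * (2 * A)) (hR : 0 < R) (hM : 0 < M)
    (hQ : LowerBound ρ Ω u R M) (hδ : M * δ = ρ * R ^ 2 / 2) (hMR : 2 * A * ρ * R ^ 2 ≤ M ^ 2)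
    (hδρ : δ ≤ ρ) (hAδ : A * δ ≤ ρ ^ 2 / 4) :
    ∃ y ∈ closure Ω, height y = δ ∧ u y ≤ ρ * R ^ 2 / 2 := by
  by_contra! hcon
  have hδ0 : 0 < δ := by
    have : 0 < M * δ := by rw [hδ]; positivity
    exact pos_of_mul_pos_right this hM.le
  have hAδ2 : A * δ ^ 2 ≤ ρ * R ^ 2 / 8 := by
    have h3 : M ^ 2 * (A * δ ^ 2) ≤ M ^ 2 * (ρ * R ^ 2 / 8) := by
      have : M ^ 2 * (A * δ ^ 2) = 2 * A * ρ * R ^ 2 * (ρ * R ^ 2 / 8) := by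
        calc M ^ 2 * (A * δ ^ 2) = A * (M * δ) ^ 2 := by ring
          _ = _ := by rw [hδ]; ring
      rw [this]
      gcongr
    exact le_of_mul_le_mul_left h3 (by positivity)
  -- `M/4` keeps the barrier below `ρR²/2` on the side and top; `ρ²/4` lets `ρ|x'|²` absorb it on
  -- `∂Ω`, by the tangent ball.
  set t := min (M / 4) (ρ ^ 2 / 4) with ht
  have ht0 : 0 < t := by positivity
  have htM : t ≤ M / 4 := min_le_left _ _
  have htρ : t ≤ ρ ^ 2 / 4 := min_le_right _ _
  obtain ⟨b, hb1, hb2⟩ := exists_tang_height (n := n) 0 t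
  have key : ∀ x, quad (ρ / 128) A 0 b x = t * height x + ρ / 128 * ‖tang x‖ ^ 2
      + A * height x ^ 2 := by
    intro x
    rw [quad, inner_eq_tang_add_height, hb1, hb2, inner_zero_left]
    ring
  have hfr : ∀ x ∈ frontier (truncate Ω R δ), quad (ρ / 128) A 0 b x ≤ u x := by
    intro x hx
    rw [key]
    obtain ⟨hxc, hxR, hxδ, hcases⟩ := frontier_truncate h1.isOpen hx
    have hh0 := h1.height_nonneg hxc
    have hw : t * height x + ρ / 128 * ‖tang x‖ ^ 2 + A * height x ^ 2 ≤ ρ * R ^ 2 / 2 := by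
      have e1 : t * height x ≤ M / 4 * δ := by gcongr
      have e2 : ρ / 128 * ‖tang x‖ ^ 2 ≤ ρ / 128 * R ^ 2 := by gcongr
      have e3 : A * height x ^ 2 ≤ A * δ ^ 2 := by gcongr
      have e4 : 0 < ρ * R ^ 2 := by positivity
      linarith
    rcases hcases with hf | hf | hf
    · have hp := h1.mul_height_le hρ hf (hxδ.trans hδρ)
      have e1 : t * height x ≤ ρ ^ 2 / 4 * height x := by gcongr
      have e2 : A * height x * height x ≤ ρ ^ 2 / 4 * height x := by
        gcongr
        exact (mul_le_mul_of_nonneg_left hxδ hA.le).trans hAδ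
      have e3 : 0 ≤ ρ * ‖tang x‖ ^ 2 := by positivity
      have e4 := mul_le_mul_of_nonneg_left hp hρ.le
      have := hlow x hf
      nlinarith
    · refine hw.trans ?_
      have := hQ x hxc hxR
      rw [hf] at this
      linarith [mul_le_mul_of_nonneg_left hxδ hM.le]
    · exact hw.trans (hcon x hxc hf).le
  have hcomp := quad_le_of_le_frontier (h1.isOpen.inter (isOpen_cylinder R δ))
    Set.inter_subset_left (h1.isBounded.subset Set.inter_subset_left) h2.convexOn h2.continuousOn
    hdet (by positivity) hA.le (by positivity) hK hfr
  -- Convexity along rays carries the slope bound from near the origin to all of `closure Ω`.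
  refine h2.not_supporting t ht0 fun x hx => ?_
  have hev : ∀ᶠ c : ℝ in nhdsWithin 0 (Set.Ioi 0), c • x ∈ {x : Space n | ‖tang x‖ < R ∧ height x < δ} := by
    refine Filter.Eventually.filter_mono nhdsWithin_le_nhds ?_
    have hc : Continuous fun c : ℝ => c • x := by fun_prop
    refine hc.continuousAt.eventually_mem ((isOpen_cylinder R δ).mem_nhds ?_)
    simp only [zero_smul]
    have h0t : tang (0 : Space n) = 0 := rfl
    have h0h : height (0 : Space n) = 0 := rfl
    refine ⟨?_, ?_⟩
    · rw [h0t, norm_zero]; exact hR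
    · rw [h0h]; exact hδ0
  have hev1 : ∀ᶠ c : ℝ in nhdsWithin 0 (Set.Ioi 0), c ≤ 1 :=
    Filter.Eventually.filter_mono nhdsWithin_le_nhds (eventually_le_nhds one_pos)
  obtain ⟨c, ⟨hcm, hc1⟩, hc0⟩ := ((hev.and hev1).and self_mem_nhdsWithin).exists
  have hc0 : 0 < c := hc0
  obtain ⟨hcx, hucx⟩ := h2.map_smul_le h1.zero_mem_closure hx hc0.le hc1
  have := hcomp (c • x) (mem_closure_truncate hcx hcm.1 hcm.2)
  rw [key, height_smul] at this
  have e1 : 0 ≤ ρ / 128 * ‖tang (c • x)‖ ^ 2 + A * (c * height x) ^ 2 := by positivity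
  have e2 : c * (t * height x) ≤ c * u x := by linarith
  exact le_of_mul_le_mul_left e2 hc0

theorem exists_mem_segment_frontier {E : Type*} [NormedAddCommGroup E] [NormedSpace ℝ E]
    {s : Set E} (hs : IsOpen s) {x y : E} (hx : x ∈ s) (hy : y ∉ s) :
    ∃ z ∈ segment ℝ x y, z ∈ frontier s := by
  by_contra! hcon
  have hpre : IsPreconnected (segment ℝ x y) := (convex_segment x y).isPreconnected
  have hsub : segment ℝ x y ⊆ s ∪ (closure s)ᶜ := by
    intro z hz
    by_contra hz'
    simp only [Set.mem_union, Set.mem_compl_iff, not_or, not_not] at hz'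
    exact hcon z hz (hs.frontier_eq ▸ ⟨hz'.2, hz'.1⟩)
  have := hpre.subset_left_of_subset_union hs isClosed_closure.isOpen_compl
    (disjoint_compl_right.mono_left subset_closure) hsub ⟨x, left_mem_segment ℝ x y, hx⟩
  exact hy (this (right_mem_segment ℝ x y))

theorem le_of_norm_lt (hρ : 0 < ρ) (h1 : HypH1 ρ Ω) (h2 : HypH2 Ω u)
    (hup : ∀ x ∈ frontier Ω ∩ Metric.ball 0 ρ, u x ≤ 1 / ρ * ‖tang x‖ ^ 2)
    {R M δ : ℝ} (hR : 0 < R)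
    (hQ : LowerBound ρ Ω u R M) (hδ : M * δ = ρ * R ^ 2 / 2) (hδR : δ ≤ R) (hRρ : 3 * R < ρ)
    {y : Space n} (hy : y ∈ closure Ω) (hyδ : height y = δ) (huy : u y ≤ ρ * R ^ 2 / 2)
    {x : Space n} (hx : x ∈ Ω) (hxδ : ‖x‖ < δ / 2) : u x ≤ 4 * R ^ 2 / ρ := by
  have hρR : 0 < ρ * R ^ 2 := by positivity
  have hρ1 := h1.lt_one hρ
  have hxc := subset_closure hx
  have hδ0 : 0 < δ := by linarith [norm_nonneg x]
  -- Otherwise scale `y` by `c = R/|y'| < 1`: the lower bound and convexity give `ρR² - cρR²/2 ≤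
  -- cρR²/2`.
  have hyR : ‖tang y‖ ≤ R := by
    by_contra! hlt
    have hy0 : 0 < ‖tang y‖ := hR.trans hlt
    have hc0 : 0 < R / ‖tang y‖ := by positivity
    have hc1 : R / ‖tang y‖ < 1 := (div_lt_one hy0).mpr hlt
    obtain ⟨hcy, hucy⟩ := h2.map_smul_le h1.zero_mem_closure hy hc0.le hc1.le
    have hnorm : ‖tang ((R / ‖tang y‖) • y)‖ = R := by
      rw [tang_smul, norm_smul, Real.norm_of_nonneg hc0.le]
      field_simp
    have := hQ _ hcy hnorm.le
    rw [hnorm, height_smul, hyδ] at this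
    have e1 : R / ‖tang y‖ * u y ≤ R / ‖tang y‖ * (ρ * R ^ 2 / 2) := by gcongr
    have e2 : M * (R / ‖tang y‖ * δ) = R / ‖tang y‖ * (ρ * R ^ 2 / 2) := by rw [← hδ]; ring
    nlinarith
  have hxh := (le_abs_self _).trans (abs_height_le x)
  have hxt := norm_tang_le x
  -- The reflection of `y` in `x` has negative height, so the segment to it from `x` meets `∂Ω`.
  have hp : x + (x - y) ∉ Ω := by
    intro hmem
    have := h1.subset_halfSpace _ hmem
    rw [height_add, height_sub, hyδ] at this
    linarith
  obtain ⟨z, hz, hzf⟩ := exists_mem_segment_frontier h1.isOpen hx hp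
  rw [segment_eq_image'] at hz
  obtain ⟨τ, ⟨hτ0, hτ1⟩, hzτ⟩ := hz
  have hz' : z = x + τ • (x - y) := by rw [← hzτ]; simp
  have hzt : ‖tang z‖ ≤ 2 * R := by
    rw [hz', tang_add, tang_smul, tang_sub]
    calc ‖tang x + τ • (tang x - tang y)‖ ≤ ‖tang x‖ + ‖τ • (tang x - tang y)‖ := norm_add_le _ _
      _ ≤ ‖tang x‖ + 1 * (‖tang x‖ + ‖tang y‖) := by
        rw [norm_smul, Real.norm_of_nonneg hτ0]
        gcongr
        exact norm_sub_le _ _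
      _ ≤ 2 * R := by linarith
  have hzc := frontier_subset_closure hzf
  have hzh0 := h1.height_nonneg hzc
  have hzh : height z ≤ height x := by
    rw [hz', height_add, height_smul, height_sub, hyδ]
    nlinarith
  have hzn : ‖z‖ < ρ := by
    have := norm_le_tang_add_height z
    rw [abs_of_nonneg hzh0] at this
    linarith
  have huz : u z ≤ 4 * R ^ 2 / ρ := by
    refine (hup z ⟨hzf, by simpa using hzn⟩).trans ?_
    calc 1 / ρ * ‖tang z‖ ^ 2 ≤ 1 / ρ * (2 * R) ^ 2 := by gcongr
      _ = 4 * R ^ 2 / ρ := by ring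
  have huy' : u y ≤ 4 * R ^ 2 / ρ := by
    refine huy.trans ?_
    rw [le_div_iff₀ hρ]
    nlinarith [mul_pos hρ hρ, pow_pos hR 2]
  have hxseg : x ∈ segment ℝ z y := by
    refine ⟨1 / (1 + τ), τ / (1 + τ), by positivity, by positivity, by field_simp, ?_⟩
    rw [hz']
    have hne : (1 : ℝ) + τ ≠ 0 := by positivity
    have : (1 / (1 + τ)) • (x + τ • (x - y)) + (τ / (1 + τ)) • y
        = ((1 + τ) / (1 + τ)) • x := by
      module
    rw [this, div_self hne, one_smul]
  exact (h2.convexOn.le_on_segment hzc hy hxseg).trans (max_le huz huy')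

end DegenerateMA

/-! ### Choice of constants -/

theorem proposition3p3 (n : ℕ) (ρ : ℝ) (hρ : 0 < ρ) :
    ∃ C' c' : ℝ, 0 < C' ∧ 0 < c' ∧
      ∀ (Ω : Set (DegenerateMA.Space n)) (u : DegenerateMA.Space n → ℝ),
        DegenerateMA.HypH1 ρ Ω →
        DegenerateMA.HypH2 Ω u →
        (∀ x ∈ frontier Ω, ρ * ‖DegenerateMA.tang x‖ ^ 2 ≤ u x) →
        (∀ x ∈ frontier Ω ∩ Metric.ball 0 ρ, u x ≤ 1 / ρ * ‖DegenerateMA.tang x‖ ^ 2) →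
        DegenerateMA.DetHessianLE Ω u (1 / ρ) →
        ∀ x ∈ Ω ∩ Metric.ball 0 c', u x ≤ C' * ‖x‖ ^ (4 / 3 : ℝ) := by
  obtain ⟨A, hA, hK⟩ : ∃ A : ℝ, 0 < A ∧ 1 / ρ < (2 * (ρ / 128)) ^ n * (2 * A) := by
    refine ⟨1 / ρ / (2 * (ρ / 128)) ^ n, by positivity, ?_⟩
    have hpos : 0 < 1 / ρ := by positivity
    have : (2 * (ρ / 128)) ^ n * (2 * (1 / ρ / (2 * (ρ / 128)) ^ n)) = 2 * (1 / ρ) := by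
      field_simp
    linarith
  obtain ⟨M, hM1, hMρ, hMA, hMA3⟩ : ∃ M : ℝ, 1 ≤ M ∧ 1 / ρ ^ 2 ≤ M ∧ 1024 * A / ρ ≤ M ∧
      A / ρ ^ 3 ≤ M := by
    have e1 : 0 < 1 / ρ ^ 2 := by positivity
    have e2 : 0 < 1024 * A / ρ := by positivity
    have e3 : 0 < A / ρ ^ 3 := by positivity
    exact ⟨1 + 1 / ρ ^ 2 + 1024 * A / ρ + A / ρ ^ 3, by linarith, by linarith, by linarith,
      by linarith⟩
  have hM : 0 < M := by linarith
  have hMA1 : A / ρ ≤ M := by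
    have : 0 < A / ρ := by positivity
    have e : 1024 * A / ρ = 1024 * (A / ρ) := by ring
    linarith
  have hM2 : 1024 * A * ρ * (1 / ρ) ^ 2 ≤ M ^ 2 := by
    have e : 1024 * A * ρ * (1 / ρ) ^ 2 = 1024 * A / ρ := by field_simp
    rw [e]
    nlinarith
  -- With `R = q²/ρ`, slope `16Mq` and `δ = kq³`, this `k` makes slope times `δ` equal to `ρR²/2`.
  set k : ℝ := 1 / (32 * ρ * M) with hk
  have hk0 : 0 < k := by positivity
  refine ⟨4 / ρ ^ 3 * (4 / k) ^ (4 / 3 : ℝ), k * (ρ / 2) ^ 3 / 4, by positivity, by positivity, ?_⟩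
  rintro Ω u h1 h2 hlow hup hdet x ⟨hx, hxb⟩
  have hρ1 := h1.lt_one hρ
  have hx0 : 0 < ‖x‖ := by
    have := (le_abs_self _).trans (DegenerateMA.abs_height_le x)
    exact (h1.subset_halfSpace x hx).trans_le this
  have hxc : ‖x‖ < k * (ρ / 2) ^ 3 / 4 := by simpa using hxb
  -- Chosen so that `‖x‖ = δ/4`; the radius `c'` amounts to `q < ρ/2`, which gives `3R < ρ`.
  set q : ℝ := (4 / k * ‖x‖) ^ (1 / 3 : ℝ) with hq
  have hq0 : 0 < q := by positivity
  have hq3 : q ^ 3 = 4 / k * ‖x‖ := by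
    rw [hq, ← Real.rpow_natCast, ← Real.rpow_mul (by positivity)]
    norm_num
  have hq4 : q ^ 4 = (4 / k) ^ (4 / 3 : ℝ) * ‖x‖ ^ (4 / 3 : ℝ) := by
    rw [hq, ← Real.rpow_natCast, ← Real.rpow_mul (by positivity),
      ← Real.mul_rpow (by positivity) (by positivity)]
    norm_num
  have hqρ : q < ρ / 2 := by
    refine lt_of_pow_lt_pow_left₀ 3 (by positivity) ?_
    rw [hq3, div_mul_eq_mul_div, div_lt_iff₀ hk0]
    linarith
  have hq1 : q ≤ 1 := by linarith
  have hQ := DegenerateMA.lowerBound_all hρ h1 h2 hlow hdet hA hK hM hMA1 hM2 hq0 hq1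
  have hδ : 16 * M * q * (k * q ^ 3) = ρ * (q ^ 2 / ρ) ^ 2 / 2 := by
    rw [hk]
    field_simp
    norm_num
  have hq31 : q ^ 3 ≤ 1 := pow_le_one₀ hq0.le hq1
  have hkq : k * q ^ 3 ≤ k := mul_le_of_le_one_right hk0.le hq31
  have hkρ : k ≤ ρ := by
    rw [hk, div_le_iff₀ (by positivity)]
    rw [div_le_iff₀ (by positivity)] at hMρ
    nlinarith
  have hAk : A * k ≤ ρ ^ 2 / 4 := by
    rw [hk, mul_one_div, div_le_iff₀ (by positivity)]
    rw [div_le_iff₀ (by positivity)] at hMA3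
    nlinarith
  have hMR : 2 * A * ρ * (q ^ 2 / ρ) ^ 2 ≤ (16 * M * q) ^ 2 := by
    have e1 : 2 * A * ρ * (q ^ 2 / ρ) ^ 2 = 1 / 512 * (1024 * A * ρ * (1 / ρ) ^ 2) * q ^ 2 * q ^ 2 := by
      ring
    have e2 : q ^ 2 ≤ 1 := pow_le_one₀ hq0.le hq1
    calc 2 * A * ρ * (q ^ 2 / ρ) ^ 2 = 1 / 512 * (1024 * A * ρ * (1 / ρ) ^ 2) * q ^ 2 * q ^ 2 := e1
      _ ≤ 1 / 512 * M ^ 2 * q ^ 2 * 1 := by gcongr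
      _ ≤ (16 * M * q) ^ 2 := by nlinarith [sq_nonneg (M * q)]
  have hδR : k * q ^ 3 ≤ q ^ 2 / ρ := by
    have e1 : k * ρ ≤ 1 := by nlinarith
    rw [le_div_iff₀ hρ]
    calc k * q ^ 3 * ρ = (k * ρ) * q * q ^ 2 := by ring
      _ ≤ 1 * 1 * q ^ 2 := by gcongr
      _ = q ^ 2 := by ring
  have hRρ : 3 * (q ^ 2 / ρ) < ρ := by
    rw [← mul_div_assoc, div_lt_iff₀ hρ]
    nlinarith
  obtain ⟨y, hy, hyδ, huy⟩ := DegenerateMA.exists_le_at_height hρ h1 h2 hlow hdet hA hK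
    (by positivity) (by positivity) hQ hδ hMR (hkq.trans hkρ)
    ((mul_le_mul_of_nonneg_left hkq hA.le).trans hAk)
  have := DegenerateMA.le_of_norm_lt hρ h1 h2 hup (by positivity) hQ hδ hδR hRρ
    hy hyδ huy hx (by rw [hq3]; field_simp; linarith)
  calc u x ≤ 4 * (q ^ 2 / ρ) ^ 2 / ρ := this
    _ = 4 / ρ ^ 3 * q ^ 4 := by field_simp
    _ = _ := by rw [hq4]; ring
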